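/- **Notation.** $S_n$ is the set of permutations $\sigma=[\sigma(1),\dots,\sigma(n)]$ of $[n]=\{1,\dots,n\}$. For $1\le i<j\le n$, the transition $t_{i\uparrow j}:S_n\to S_n$ moves the entry in position $j$ to position $i$ and shifts the entries in positions $i,\dots,j-1$ one place to the right; $t_{\uparrow j}=t_{1\uparrow j}$. A $G_{i\uparrow}(n,M)$ is a sequence $(c_r)_{r=1}^M$ of distinct elements of $S_n$ with $c_{r+1}=t_{i\uparrow j_r}(c_r)$ for $1\le r<M$ and $c_1=t_{i\uparrow j_M}(c_M)$, for some $j_1,\dots,j_M\in\{i+1,\dots,n\}$; $t_{i\uparrow j_1},\dots,t_{i\uparrow j_M}$ is its transition sequence, and $G_\uparrow=G_{1\uparrow}$. A $G^{\mathrm{aux}}_\uparrow(k,M)$ is a $G_\uparrow(k,M)$ code $C$ such that $\sigma\in C$ implies $(q,k)\circ\sigma\notin C$ for all $q\in[k-1]$. For $k\ge 3$ let $$\tilde M_k=\begin{cases}8&k=4,\\57&k=5,\\178&k=6,\\ \frac{k!}{2}&k\ne5\text{ odd},\\ \rho_k\frac{k!}{2}&k>6\text{ even},\end{cases}\qquad\text{where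 } \rho_k\frac{k!}{2}=(k-3)\Bigl(\frac{(k-1)!}{2}+2\Bigr)+1 .$$ **Construction.** Let $n>d\ge1$. For $i\in[d]$ let $\mathcal R_i$ be the set of elements of $[n]$ congruent to $i$ modulo $d$, and let $p_m=1+\sum_{i<m}|\mathcal R_i|$. Let $\sigma_0=[\mathcal R_1|\mathcal R_2|\cdots|\mathcal R_d]\in S_n$ be the concatenation of these classes, with any order within each class. Codes $C_m$, each starting at $\sigma_0$ and using transitions $t_{p_m\uparrow j}$, are defined by descending recursion, down to $m=1$. - Base, if $n\ge 2d$: take the transition sequence $t_{\uparrow r_1},t_{\uparrow r_2},\dots$ of any $G_\uparrow(|\mathcal R_d|,|\mathcal R_d|!)$; $C_d$ has the transition sequence $t_{p_d\uparrow p_d-1+r_1},t_{p_d\uparrow p_d-1+r_2},\dots$. - Base, if $n<2d$: for $m=n\bmod d$, $C_m=(\sigma_0,\;t_{2m-1\uparrow2m+1}\sigma_0,\;t_{2m-1\uparrow2m+1}^{2}\sigma_0)$. - Step from $C_{m+1}$ to $C_m$: let $k=|\mathcal R_m|$ and take any $G^{\mathrm{aux}}_\uparrow(k+1,\tilde M_{k+1})$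 code that starts at the identity and whose transition sequence $t_{\uparrow k+1},t_{\uparrow i_2},\dots,t_{\uparrow i_{\tilde M_{k+1}}}$ starts with $t_{\uparrow k+1}$. Replace each transition $t_{p_{m+1}\uparrow j}$ of $C_{m+1}$ with $t_{p_m\uparrow j}$ followed by $t_{p_m\uparrow p_m-1+i_2},\dots,t_{p_m\uparrow p_m-1+i_{\tilde M_{k+1}}}$. **Lemma.** Let $n>d\ge1$ and let $C_1$ be a code obtained by this construction, with any choice of the codes and orders it employs. Then the number $|C_1|$ of its codewords is $$|C_1|=\begin{cases} \left(\lceil\frac nd\rceil+1\right)^{n\bmod d}\left((\lfloor\frac nd\rfloor+1)!\right)^d\cdot\dfrac{\rho_{\lceil n/d\rceil+1}^{\,n\bmod d}}{2^{d-1}(\lfloor n/d\rfloor+1)} & 4<\lfloor\frac nd\rfloor\equiv0\pmod2,\\[1ex] \left(\frac{178}{57}\right)^{n\bmod d}\cdot57^{d-1}\cdot24&\lfloor\frac nd\rfloor=4,\\[1ex] \left(\frac83\right)^{n\bmod d}\cdot3^{d-1}\cdot2&\lfloor\frac nd\rfloor=2,\\[1ex] \left(\lceil\frac nd\rceil+1\right)^{n\bmod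 d}\left((\lfloor\frac nd\rfloor+1)!\right)^d\cdot\dfrac{\rho_{\lfloor n/d\rfloor+1}^{\,(d-1)-(n\bmod d)}}{2^{d-1}(\lfloor n/d\rfloor+1)} & 5<\lfloor\frac nd\rfloor\equiv1\pmod2,\\[1ex] \left(\frac{1260}{89}\right)^{n\bmod d}\cdot178^d\cdot\frac{120}{178}&\lfloor\frac nd\rfloor=5,\\[1ex] \left(\frac{57}{8}\right)^{n\bmod d}\cdot8^d\cdot\frac34&\lfloor\frac nd\rfloor=3,\\[1ex] 3^{n\bmod d}&\lfloor\frac nd\rfloor=1. \end{cases}$$ (When $d\mid n$, the factor $\rho_{\lceil n/d\rceil+1}^{\,n\bmod d}$ is $1$.) Moreover $\rho_k>\frac{k-3}{k}$ for all even $k>6$. -/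

import Mathlib

namespace PushGray

open Equiv

/-! ## Push transitions and push-to-the-`i`th-index Gray codes

The set `{1, …, n}` is modelled by `Fin n`: positions, values and classes are numbered from `0`.
A permutation `σ : Perm (Fin n)` has vector notation `[σ 0, σ 1, …, σ (n - 1)]`. -/

/-- The transition `t_{i↑j}` on `S_n`: the entry in position `j` is moved to position `i`, and the
entries in positions `i, …, j - 1` move one position to the right. Only used for `i < j < n`; for
other indices it is the identity. In terms of the group it is `σ ↦ σ ∘ (j, j - 1, …, i)`. -/
def push {n : ℕ} (i j : ℕ) (σ : Perm (Fin n)) : Perm (Fin n) :=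
  if h : i < j ∧ j < n then σ * (Fin.cycleIcc ⟨i, h.1.trans h.2⟩ ⟨j, h.2⟩)⁻¹ else σ

/-- The codewords `c_1 = σ, c_2 = t_{i↑j_1} c_1, …, c_M = t_{i↑j_{M-1}} c_{M-1}` of the cyclic
sequence with generating transition sequence `t_{i↑j_1}, …, t_{i↑j_M}`. -/
def codewords {n : ℕ} (i : ℕ) : Perm (Fin n) → List ℕ → List (Perm (Fin n))
  | _, [] => []
  | σ, j :: js => σ :: codewords i (push i j σ) js

/-- The transitions `t_{i↑j_1}, …, t_{i↑j_M}`, applied from `σ`, generate a `G_{i↑}(n, M)`: a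
cyclic Gray code over `S_n`, with distinct codewords, the last transition leading back to `σ`. -/
structure IsPushCode {n : ℕ} (i : ℕ) (σ : Perm (Fin n)) (js : List ℕ) : Prop where
  transitions : ∀ j ∈ js, i < j ∧ j < n
  distinct : (codewords i σ js).Nodup
  cyclic : js.foldl (fun π j => push i j π) σ = σ

/-- The sizes of the auxiliary codes in `S_k`, for `k ≥ 3`. -/
def auxSize (k : ℕ) : ℕ :=
  if k = 4 then 8
  else if k = 5 then 57
  else if k = 6 then 178
  else if k % 2 = 1 then k.factorial / 2
  else (k - 3) * ((k - 1).factorial / 2 + 2) + 1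

/-- The factor `ρ_k`, for even `k > 6`: the ratio of the auxiliary code size to `k! / 2`. -/
def rho (k : ℕ) : ℚ :=
  (((k : ℚ) - 3) * (((k - 1).factorial : ℚ) / 2 + 2) + 1) / ((k.factorial : ℚ) / 2)

/-- `js` is the transition sequence of a `G^aux_↑(k, auxSize k)` that starts with the identity and
the transition `t_{↑k}`: a cyclic push-to-the-top Gray code `C` such that `π ∈ C` implies
`(q, k) ∘ π ∉ C` for all `q ≠ k`. -/
structure IsAuxCode (k : ℕ) (js : List ℕ) : Prop where
  isPushCode : IsPushCode 0 (1 : Perm (Fin k)) js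
  length_eq : js.length = auxSize k
  head_eq : js.head? = some (k - 1)
  aux : ∀ π ∈ codewords 0 (1 : Perm (Fin k)) js, ∀ q l : Fin k, (l : ℕ) + 1 = k → q ≠ l →
    swap q l * π ∉ codewords 0 (1 : Perm (Fin k)) js

/-- `js` is the transition sequence of a complete cyclic `G_↑(k, k!)`. -/
def IsCompleteCode (k : ℕ) (js : List ℕ) : Prop :=
  js.length = k.factorial ∧ ∃ σ : Perm (Fin k), IsPushCode 0 σ js

/-! ## The construction -/

/-- The size of the congruence class `m` modulo `d` of `{0, …, n - 1}`. -/
def classSize (n d m : ℕ) : ℕ := ((Finset.range n).filter fun v => v % d = m).card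

/-- The number of elements of the classes `0, …, m - 1`. -/
def classStart (n d m : ℕ) : ℕ := ∑ i ∈ Finset.range m, classSize n d i

/-- `σ₀ = [R_0 | R_1 | ⋯ | R_{d-1}]`: the concatenation of the congruence classes modulo `d`,
with an arbitrary order within each class. -/
def IsInitial {n : ℕ} (d : ℕ) (σ₀ : Perm (Fin n)) : Prop :=
  ∀ m < d, ∀ p : Fin n, classStart n d m ≤ p → (p : ℕ) < classStart n d (m + 1) →
    (σ₀ p : ℕ) % d = m

/-- The recursion step: each `t_{p'↑j}` is replaced with `t_{p↑j}`, followed by the auxiliary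
transitions except the first one, carried out on the positions `p, p + 1, …`. -/
def expand (p : ℕ) (aux js : List ℕ) : List ℕ :=
  js.flatMap fun j => j :: aux.tail.map fun i => p + i

/-- `IsStage n d m js`: the construction, with parameters `n` and `d` and with some choice of the
codes it employs, produces for the class `m` the transition sequence `t_{p↑j}`, `j ∈ js`, where
`p = classStart n d m`. With classes numbered from `1` this is the code `C_{m+1}`.

* `base`: for `2 * d ≤ n`, the code `C_d` runs through all arrangements of the last class.
* `baseSmall`: for `n < 2 * d`, the recursion starts with `C_r`, `r = n mod d`, which consists of
  three cyclic shifts of the class `R_r` (of size 2) together with one more element.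
* `step`: the recursion step from `C_{m+2}` to `C_{m+1}`. -/
inductive IsStage (n d : ℕ) : ℕ → List ℕ → Prop
  | base (js : List ℕ) (hn : 2 * d ≤ n) (hjs : IsCompleteCode (classSize n d (d - 1)) js) :
      IsStage n d (d - 1) (js.map fun j => classStart n d (d - 1) + j)
  | baseSmall (hn : n < 2 * d) :
      IsStage n d (n % d - 1) (List.replicate 3 (2 * (n % d)))
  | step (m : ℕ) (js aux : List ℕ) (hjs : IsStage n d (m + 1) js)
      (haux : IsAuxCode (classSize n d m + 1) aux) :
      IsStage n d m (expand (classStart n d m) aux js)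

/-- The sequence `C` of permutations is the final code `C_1` of a run of the construction with
parameters `n` and `d`. All its transitions are push-to-the-top transitions. -/
def IsConstructedCode (n d : ℕ) (C : List (Perm (Fin n))) : Prop :=
  ∃ (σ₀ : Perm (Fin n)) (js : List ℕ), IsInitial d σ₀ ∧ IsStage n d 0 js ∧ C = codewords 0 σ₀ js

/-! ## The size formula -/

/-- The case formula for the size of the code. -/
def codeSize (n d : ℕ) : ℚ :=
  let f : ℕ := ⌊(n : ℚ) / d⌋₊
  let c : ℕ := ⌈(n : ℚ) / d⌉₊
  let r : ℕ := n % d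
  if 4 < f ∧ f % 2 = 0 then
    ((c : ℚ) + 1) ^ r * ((f + 1).factorial : ℚ) ^ d * (rho (c + 1) ^ r / (2 ^ (d - 1) * (f + 1)))
  else if f = 4 then (178 / 57) ^ r * 57 ^ (d - 1) * 24
  else if f = 2 then (8 / 3) ^ r * 3 ^ (d - 1) * 2
  else if 5 < f ∧ f % 2 = 1 then
    ((c : ℚ) + 1) ^ r * ((f + 1).factorial : ℚ) ^ d *
      (rho (f + 1) ^ (d - 1 - r) / (2 ^ (d - 1) * (f + 1)))
  else if f = 5 then (1260 / 89) ^ r * 178 ^ d * (120 / 178)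
  else if f = 3 then (57 / 8) ^ r * 8 ^ d * (3 / 4)
  else 3 ^ r

end PushGray

/-!
Consider the step that expands a code `c_1, c_2, …` at index `p + k` to index `p`. Since `t_{p↑j}`
is `t_{p+k↑j}` followed by `t_{p↑p+k}`, and `t_{p↑p+k}` is the first transition of the auxiliary
code on the window of positions `p, …, p + k`, the expanded code is, up to a rotation, the
concatenation of the auxiliary cycles through `c_1, c_2, …`. Two such cycles are disjoint: the `c_r`
agree on all positions before `p + k`, and a rearrangement of the window that fixes all positions
but the last one is trivial. Hence each step multiplies the number of codewords by the size of the
auxiliary code, and the case formula evaluates the resulting product.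
-/

namespace PushGray

open Equiv Finset

/-! ## Transitions within a window of positions -/

theorem push_of_lt {n i j : ℕ} (hij : i < j) (hj : j < n) (σ : Perm (Fin n)) :
    push i j σ = σ * (Fin.cycleIcc ⟨i, hij.trans hj⟩ ⟨j, hj⟩)⁻¹ :=
  dif_pos ⟨hij, hj⟩

theorem push_apply_of_lt {n i : ℕ} (j : ℕ) (σ : Perm (Fin n)) {x : Fin n} (hx : (x : ℕ) < i) :
    push i j σ x = σ x := by
  unfold push
  split_ifs
  · rw [Perm.mul_apply, Perm.inv_eq_iff_eq.2 (Fin.cycleIcc_of_lt (Fin.lt_def.2 hx)).symm]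
  · rfl

theorem push_push {n i j l : ℕ} (hij : i < j) (hjl : j < l) (hl : l < n) (σ : Perm (Fin n)) :
    push i j (push j l σ) = push i l σ := by
  have : NeZero n := ⟨by lia⟩
  rw [push_of_lt hij (hjl.trans hl), push_of_lt hjl hl, push_of_lt (hij.trans hjl) hl, mul_assoc,
    ← mul_inv_rev]
  congr 2
  exact DFunLike.coe_injective
    (Fin.cycleIcc.trans (Fin.mk_le_mk.2 hij.le) (Fin.mk_le_mk.2 hjl.le))

section Window

variable {n k p : ℕ}

/-- The window of the `k` consecutive positions `p, …, p + k - 1` among the positions of `S_n`. -/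
def window (h : p + k ≤ n) : Fin k ↪ Fin n :=
  (Fin.natAddEmb p).trans (Fin.castLEEmb h)

/-- The group `S_k`, acting on the positions within a window and fixing all other positions. -/
noncomputable def windowHom (h : p + k ≤ n) : Perm (Fin k) →* Perm (Fin n) :=
  Perm.viaEmbeddingHom (window h)

theorem val_window (h : p + k ≤ n) (i : Fin k) : (window h i : ℕ) = p + i :=
  rfl

theorem window_strictMono (h : p + k ≤ n) : StrictMono (window h) :=
  fun _ _ hij => Nat.add_lt_add_left hij p

theorem mem_range_window (h : p + k ≤ n) {x : Fin n} :
    x ∈ Set.range (window h) ↔ p ≤ x ∧ (x : ℕ) < p + k := by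
  constructor
  · rintro ⟨i, rfl⟩
    rw [val_window]
    lia
  · rintro ⟨hp, hk⟩
    exact ⟨⟨x - p, by lia⟩, Fin.ext (Nat.add_sub_cancel' hp)⟩

theorem windowHom_injective (h : p + k ≤ n) : Function.Injective (windowHom h) :=
  Perm.viaEmbeddingHom_injective _

theorem windowHom_apply_window (h : p + k ≤ n) (π : Perm (Fin k)) (i : Fin k) :
    windowHom h π (window h i) = window h (π i) :=
  Perm.viaEmbedding_apply π (window h) i

theorem windowHom_apply_of_notMem (h : p + k ≤ n) (π : Perm (Fin k)) {x : Fin n}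
    (hx : x ∉ Set.range (window h)) : windowHom h π x = x :=
  Perm.viaEmbedding_apply_of_notMem π (window h) x hx

theorem windowHom_cycleIcc (h : p + k ≤ n) {i j : Fin k} (hij : i ≤ j) :
    windowHom h (Fin.cycleIcc i j) = Fin.cycleIcc (window h i) (window h j) := by
  have : NeZero k := ⟨by lia⟩
  have : NeZero n := ⟨by lia⟩
  have hmono := window_strictMono h
  ext x
  by_cases hx : x ∈ Set.range (window h)
  · obtain ⟨y, rfl⟩ := hx
    rw [windowHom_apply_window]
    rcases lt_or_ge y i with hyi | hiy
    · rw [Fin.cycleIcc_of_lt hyi, Fin.cycleIcc_of_lt (hmono hyi)]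
    rcases lt_trichotomy y j with hyj | rfl | hjy
    · have hlt : (window h y : ℕ) < window h j := hmono hyj
      rw [Fin.cycleIcc_of_ge_of_lt hiy hyj,
        Fin.cycleIcc_of_ge_of_lt (hmono.monotone hiy) (hmono hyj), val_window,
        Fin.val_add_one_of_lt' (by lia), Fin.val_add_one_of_lt' (by lia), val_window, add_assoc]
    · rw [Fin.cycleIcc_of_last hij, Fin.cycleIcc_of_last (hmono.monotone hij)]
    · rw [Fin.cycleIcc_of_gt hjy, Fin.cycleIcc_of_gt (hmono hjy)]
  · rw [windowHom_apply_of_notMem h _ hx]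
    rw [mem_range_window, not_and_or, not_le, not_lt] at hx
    rcases hx with hx | hx
    · rw [Fin.cycleIcc_of_lt (Fin.lt_def.2 (by rw [val_window]; lia))]
    · rw [Fin.cycleIcc_of_gt (Fin.lt_def.2 (by rw [val_window]; lia))]

theorem push_mul_windowHom (h : p + k ≤ n) {i j : ℕ} (hij : i < j) (hj : j < k)
    (σ : Perm (Fin n)) (π : Perm (Fin k)) :
    push (p + i) (p + j) (σ * windowHom h π) = σ * windowHom h (push i j π) := by
  rw [push_of_lt (by lia) (by lia), push_of_lt hij hj, map_mul, map_inv,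
    windowHom_cycleIcc h (Fin.mk_le_mk.2 hij.le), mul_assoc]
  rfl

theorem windowHom_eq_one_of_fixes_lt (h : p + (k + 1) ≤ n) {π : Perm (Fin (k + 1))}
    (hπ : ∀ x : Fin n, (x : ℕ) < p + k → windowHom h π x = x) : windowHom h π = 1 := by
  have hlast : ∀ x ∈ (windowHom h π).support, (x : ℕ) = p + k := by
    intro x hx
    rw [Perm.mem_support] at hx
    have hlt : ¬ (x : ℕ) < p + k := fun hlt => hx (hπ x hlt)
    have hmem : x ∈ Set.range (window h) :=
      not_not.1 fun hmem => hx (windowHom_apply_of_notMem h π hmem)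
    have := (mem_range_window h).1 hmem
    lia
  rw [← Perm.card_support_le_one, card_le_one]
  exact fun x hx y hy => Fin.ext ((hlast x hx).trans (hlast y hy).symm)

theorem eq_of_mul_windowHom_eq (h : p + (k + 1) ≤ n) {c c' : Perm (Fin n)}
    (hc : ∀ x : Fin n, (x : ℕ) < p + k → c x = c' x) {π π' : Perm (Fin (k + 1))}
    (he : c * windowHom h π = c' * windowHom h π') : c = c' := by
  have hquot : windowHom h (π' * π⁻¹) = c'⁻¹ * c := by
    rw [map_mul, map_inv, mul_inv_eq_iff_eq_mul, mul_assoc, he, inv_mul_cancel_left]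
  have hone : windowHom h (π' * π⁻¹) = 1 := windowHom_eq_one_of_fixes_lt h fun x hx => by
    rw [hquot, Perm.mul_apply, hc x hx, Perm.coe_inv, symm_apply_apply]
  exact (inv_mul_eq_one.1 (hquot.symm.trans hone)).symm

end Window

/-! ## Sequences of transitions -/

/-- The permutation reached from `σ` by the transitions `t_{i↑j}`, `j ∈ js`; a transition sequence
is cyclic if its endpoint is its starting point. -/
abbrev endpoint {n : ℕ} (i : ℕ) (σ : Perm (Fin n)) (js : List ℕ) : Perm (Fin n) :=
  js.foldl (fun π j => push i j π) σ

section Codewords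

variable {n k p i : ℕ} {σ : Perm (Fin n)} {l : List ℕ}

theorem length_codewords (i : ℕ) (l : List ℕ) (σ : Perm (Fin n)) :
    (codewords i σ l).length = l.length := by
  induction l generalizing σ with
  | nil => rfl
  | cons j l ih => rw [codewords, List.length_cons, List.length_cons, ih]

theorem codewords_append (i : ℕ) (l l' : List ℕ) (σ : Perm (Fin n)) :
    codewords i σ (l ++ l') = codewords i σ l ++ codewords i (endpoint i σ l) l' := by
  induction l generalizing σ with
  | nil => rfl
  | cons j l ih => rw [List.cons_append, codewords, ih]; rfl

theorem apply_eq_of_mem_codewords {c : Perm (Fin n)} (hc : c ∈ codewords i σ l) {x : Fin n}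
    (hx : (x : ℕ) < i) : c x = σ x := by
  induction l generalizing σ with
  | nil => exact absurd hc List.not_mem_nil
  | cons j l ih =>
    rcases List.mem_cons.1 hc with rfl | hc
    · rfl
    · rw [ih hc, push_apply_of_lt j σ hx]

theorem codewords_mul_windowHom (h : p + k ≤ n) (hl : ∀ j ∈ l, 0 < j ∧ j < k)
    (σ : Perm (Fin n)) (π : Perm (Fin k)) :
    codewords p (σ * windowHom h π) (l.map (p + ·)) =
      (codewords 0 π l).map (σ * windowHom h ·) := by
  induction l generalizing π with
  | nil => rfl
  | cons j l ih =>
    obtain ⟨hj, hl⟩ := List.forall_mem_cons.1 hl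
    simp only [List.map_cons, codewords]
    rw [← ih hl, ← push_mul_windowHom h hj.1 hj.2]
    rfl

theorem endpoint_mul_windowHom (h : p + k ≤ n) (hl : ∀ j ∈ l, 0 < j ∧ j < k)
    (σ : Perm (Fin n)) (π : Perm (Fin k)) :
    endpoint p (σ * windowHom h π) (l.map (p + ·)) = σ * windowHom h (endpoint 0 π l) := by
  induction l generalizing π with
  | nil => rfl
  | cons j l ih =>
    obtain ⟨hj, hl⟩ := List.forall_mem_cons.1 hl
    simp only [endpoint, List.map_cons, List.foldl_cons] at ih ⊢
    rw [← ih hl, ← push_mul_windowHom h hj.1 hj.2]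
    rfl

theorem IsPushCode.map_window (h : p + k ≤ n) {π : Perm (Fin k)} (hl : IsPushCode 0 π l)
    (σ : Perm (Fin n)) : IsPushCode p σ (l.map (p + ·)) := by
  obtain ⟨τ, rfl⟩ : ∃ τ, τ * windowHom h π = σ := ⟨σ * (windowHom h π)⁻¹, by simp⟩
  refine ⟨List.forall_mem_map.2 fun j hj => ?_, ?_, ?_⟩
  · have := hl.transitions j hj
    lia
  · rw [codewords_mul_windowHom h hl.transitions]
    exact hl.distinct.map fun a b hab => windowHom_injective h (mul_left_cancel hab)
  · exact (endpoint_mul_windowHom h hl.transitions τ π).trans (by rw [endpoint, hl.cyclic])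

theorem exists_mul_windowHom_of_mem_codewords (h : p + k ≤ n) (hl : ∀ j ∈ l, 0 < j ∧ j < k)
    {c : Perm (Fin n)} (hc : c ∈ codewords p σ (l.map (p + ·))) :
    ∃ π, σ * windowHom h π = c := by
  rw [← mul_one σ, ← map_one (windowHom h), codewords_mul_windowHom h hl] at hc
  obtain ⟨π, -, hπ⟩ := List.mem_map.1 hc
  exact ⟨π, hπ⟩

theorem IsPushCode.conjugate (hl : IsPushCode i σ l) {r l' : List ℕ} (hr : r ++ l' = l ++ r) :
    IsPushCode i (endpoint i σ r) l' := by
  have hend : endpoint i σ l = σ := hl.cyclic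
  refine ⟨fun j hj => hl.transitions j ?_, ?_, ?_⟩
  · have hperm : l'.Perm l :=
      (List.perm_append_left_iff r).1 (.trans (.of_eq hr) List.perm_append_comm)
    exact hperm.subset hj
  · have hcode := congrArg (codewords i σ) hr
    rw [codewords_append, codewords_append, hend] at hcode
    have hperm : (codewords i (endpoint i σ r) l').Perm (codewords i σ l) :=
      (List.perm_append_left_iff _).1 (.trans (.of_eq hcode) List.perm_append_comm)
    exact hperm.nodup_iff.2 hl.distinct
  · rw [endpoint, ← List.foldl_append, hr, List.foldl_append, hl.cyclic]

theorem isPushCode_replicate_three (h : i + 2 < n) (σ : Perm (Fin n)) :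
    IsPushCode i σ (List.replicate 3 (i + 2)) := by
  have hthree : IsPushCode 0 (1 : Perm (Fin 3)) (List.replicate 3 2) :=
    ⟨by decide, by decide, by decide⟩
  exact hthree.map_window h σ

end Codewords

/-! ## The recursion step -/

theorem append_flatMap_cons {α : Type*} (t js : List α) :
    t ++ js.flatMap (fun j => j :: t) = js.flatMap (fun j => t ++ [j]) ++ t := by
  induction js with
  | nil => simp
  | cons j js ih => simp [← ih]

section Step

variable {n k p q : ℕ} {t js : List ℕ}

theorem endpoint_push_flatMap (hpq : p < q)
    (ht : ∀ c : Perm (Fin n), endpoint p (push p q c) t = c) (hjs : ∀ j ∈ js, q < j ∧ j < n)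
    (σ : Perm (Fin n)) :
    endpoint p (push p q σ) (js.flatMap fun j => t ++ [j]) = push p q (endpoint q σ js) := by
  induction js generalizing σ with
  | nil => rfl
  | cons j js ih =>
    obtain ⟨hj, hjs⟩ := List.forall_mem_cons.1 hjs
    simp only [endpoint, List.flatMap_cons, List.foldl_append, List.foldl_cons,
      List.foldl_nil] at ht ih ⊢
    rw [ht, ← push_push hpq hj.1 hj.2, ih hjs]

theorem codewords_push_flatMap (hpq : p < q)
    (ht : ∀ c : Perm (Fin n), endpoint p (push p q c) t = c) (hjs : ∀ j ∈ js, q < j ∧ j < n)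
    (σ : Perm (Fin n)) :
    codewords p (push p q σ) (js.flatMap fun j => t ++ [j]) =
      (codewords q σ js).flatMap fun c => codewords p (push p q c) t ++ [c] := by
  induction js generalizing σ with
  | nil => rfl
  | cons j js ih =>
    obtain ⟨hj, hjs⟩ := List.forall_mem_cons.1 hjs
    rw [List.flatMap_cons, List.append_assoc, codewords_append, ht, codewords,
      List.flatMap_cons, List.singleton_append, codewords, ← push_push hpq hj.1 hj.2, ih hjs,
      List.append_assoc, List.singleton_append]

theorem disjoint_codewords_window (h : p + (k + 1) ≤ n) {l : List ℕ}
    (hl : ∀ j ∈ l, 0 < j ∧ j < k + 1) {σ c c' : Perm (Fin n)} (hc : c ∈ codewords (p + k) σ js)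
    (hc' : c' ∈ codewords (p + k) σ js) (hne : c ≠ c') :
    (codewords p c (l.map (p + ·))).Disjoint (codewords p c' (l.map (p + ·))) := by
  intro x hx hx'
  obtain ⟨π, rfl⟩ := exists_mul_windowHom_of_mem_codewords h hl hx
  obtain ⟨π', he⟩ := exists_mul_windowHom_of_mem_codewords h hl hx'
  refine hne (eq_of_mul_windowHom_eq h (fun x hx => ?_) he.symm)
  rw [apply_eq_of_mem_codewords hc hx, apply_eq_of_mem_codewords hc' hx]

theorem IsPushCode.flatMap_append_singleton (h : p + (k + 1) ≤ n)
    (haux : IsPushCode 0 (1 : Perm (Fin (k + 1))) (k :: t)) {σ : Perm (Fin n)}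
    (hjs : IsPushCode (p + k) σ js) :
    IsPushCode p (push p (p + k) σ) (js.flatMap fun j => t.map (p + ·) ++ [j]) := by
  have hk : p < p + k := Nat.lt_add_of_pos_right (haux.transitions k List.mem_cons_self).1
  have hcycle (c : Perm (Fin n)) : endpoint p (push p (p + k) c) (t.map (p + ·)) = c :=
    (haux.map_window h c).cyclic
  have hblock (c : Perm (Fin n)) : (codewords p (push p (p + k) c) (t.map (p + ·)) ++ [c]).Perm
      (codewords p c ((k :: t).map (p + ·))) := List.perm_append_singleton _ _
  refine ⟨?_, ?_, ?_⟩
  · simp only [List.mem_flatMap, List.mem_append, List.mem_map, List.mem_singleton]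
    rintro _ ⟨j, hj, ⟨l, hl, rfl⟩ | rfl⟩
    · have := haux.transitions l (List.mem_cons_of_mem k hl)
      lia
    · have := hjs.transitions _ hj
      lia
  · rw [codewords_push_flatMap hk hcycle hjs.transitions, List.nodup_flatMap]
    refine ⟨fun c _ => (hblock c).nodup_iff.2 (haux.map_window h c).distinct,
      hjs.distinct.imp_of_mem fun {c c'} hc hc' hne => ?_⟩
    exact ((hblock c).disjoint_left.trans (hblock c').disjoint_right).2
      (disjoint_codewords_window h haux.transitions hc hc' hne)
  · exact (endpoint_push_flatMap hk hcycle hjs.transitions σ).trans (by rw [endpoint, hjs.cyclic])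

theorem IsPushCode.expand (h : p + (k + 1) ≤ n)
    (haux : IsPushCode 0 (1 : Perm (Fin (k + 1))) (k :: t)) {σ : Perm (Fin n)}
    (hjs : IsPushCode (p + k) σ js) : IsPushCode p σ (expand p (k :: t) js) := by
  have hrot := (haux.flatMap_append_singleton h hjs).conjugate
    (append_flatMap_cons (t.map (p + ·)) js)
  have hstart : endpoint p (push p (p + k) σ) (t.map (p + ·)) = σ := (haux.map_window h σ).cyclic
  rwa [hstart] at hrot

end Step

theorem length_expand (p : ℕ) {aux : List ℕ} (h : aux ≠ []) (js : List ℕ) :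
    (expand p aux js).length = js.length * aux.length := by
  have := List.length_pos_of_ne_nil h
  simp [expand, List.length_flatMap, Nat.sub_add_cancel this]

theorem IsAuxCode.exists_eq_cons {k : ℕ} {aux : List ℕ} (h : IsAuxCode (k + 1) aux) :
    ∃ t, aux = k :: t :=
  List.head?_eq_some_iff.1 h.head_eq

/-! ## Congruence classes -/

section Classes

variable {n d m : ℕ}

theorem classSize_eq (hm : m < d) :
    classSize n d m = n / d + if m < n % d then 1 else 0 := by
  have hcount := Nat.count_modEq_card n (r := d) (by lia) m
  simpa only [classSize, Nat.count_eq_card_filter_range, Nat.ModEq, Nat.mod_eq_of_lt hm] using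
    hcount

theorem classSize_of_lt_mod (hd : 0 < d) (hm : m < n % d) : classSize n d m = n / d + 1 := by
  rw [classSize_eq (hm.trans (Nat.mod_lt n hd)), if_pos hm]

theorem classSize_of_mod_le (hm : m < d) (hr : n % d ≤ m) : classSize n d m = n / d := by
  rw [classSize_eq hm, if_neg hr.not_gt, add_zero]

theorem classStart_succ (n d m : ℕ) : classStart n d (m + 1) = classStart n d m + classSize n d m :=
  sum_range_succ _ _

theorem classStart_self (hd : 0 < d) : classStart n d d = n := by
  have hfiber := card_eq_sum_card_fiberwise (s := range n) (t := range d) (f := (· % d))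
    fun v _ => mem_coe.2 (mem_range.2 (Nat.mod_lt v hd))
  rw [card_range] at hfiber
  exact hfiber.symm

theorem classStart_le (hm : m ≤ d) : classStart n d m ≤ n := by
  rcases d.eq_zero_or_pos with rfl | hd
  · rw [Nat.le_zero.1 hm]
    exact Nat.zero_le n
  · exact (sum_le_sum_of_subset (range_mono hm)).trans (classStart_self hd).le

theorem classStart_of_le_mod (hd : 0 < d) (hm : m ≤ n % d) :
    classStart n d m = m * (n / d + 1) := by
  rw [classStart, sum_congr rfl fun i hi => classSize_of_lt_mod hd
    ((mem_range.1 hi).trans_le hm), sum_const, card_range, smul_eq_mul]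

theorem div_eq_one_of_lt_two_mul (hn : d < n) (h2 : n < 2 * d) : n / d = 1 :=
  Nat.div_eq_of_lt_le (by lia) (by lia)

theorem mod_pos_of_lt_two_mul (hn : d < n) (h2 : n < 2 * d) : 0 < n % d := by
  rw [Nat.mod_eq_sub_mod hn.le, Nat.mod_eq_of_lt (by lia)]
  lia

end Classes

/-! ## The stages of the construction -/

section Stages

variable {n d m : ℕ} {js : List ℕ}

theorem IsStage.lt (hd : 0 < d) (h : IsStage n d m js) : m < d := by
  induction h with
  | base => lia
  | baseSmall =>
    have := Nat.mod_lt n hd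
    lia
  | step => lia

theorem IsStage.isPushCode (hd : 0 < d) (hn : d < n) (h : IsStage n d m js) (σ : Perm (Fin n)) :
    IsPushCode (classStart n d m) σ js := by
  induction h generalizing σ with
  | base js _ hjs =>
    obtain ⟨-, π, hπ⟩ := hjs
    refine hπ.map_window (le_of_eq ?_) σ
    rw [← classStart_succ, Nat.sub_add_cancel hd, classStart_self hd]
  | baseSmall h2 =>
    have hdiv := div_eq_one_of_lt_two_mul hn h2
    have hmod := mod_pos_of_lt_two_mul hn h2
    have hlast : 2 * (n % d) = (n % d - 1) * (1 + 1) + 2 := by lia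
    have hdecomp := Nat.div_add_mod n d
    have := Nat.mod_lt n hd
    rw [hdiv] at hdecomp
    rw [classStart_of_le_mod hd (Nat.sub_le _ 1), hdiv, hlast]
    exact isPushCode_replicate_three (by lia) σ
  | step m js aux hjs haux ih =>
    obtain ⟨t, rfl⟩ := haux.exists_eq_cons
    have hle : classStart n d (m + 2) ≤ n := classStart_le (hjs.lt hd)
    have hpos : 0 < classSize n d (m + 1) := by
      have := Nat.div_pos hn.le hd
      rw [classSize_eq (hjs.lt hd)]
      lia
    rw [classStart_succ, classStart_succ] at hle
    exact .expand (by lia) haux.isPushCode (classStart_succ n d m ▸ ih σ)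

theorem IsStage.length_eq (hd : 0 < d) (hn : d < n) (h : IsStage n d m js) :
    js.length = (classSize n d (d - 1)).factorial *
      ∏ i ∈ Ico m (d - 1), auxSize (classSize n d i + 1) := by
  induction h with
  | base js _ hjs => simp [hjs.1]
  | baseSmall h2 =>
    -- A class of size 1 contributes the factor `auxSize 2`, whose truncated subtraction makes it 1.
    have hdiv := div_eq_one_of_lt_two_mul hn h2
    have hmod := mod_pos_of_lt_two_mul hn h2
    have hlt := Nat.mod_lt n hd
    have hsingle : ∀ i ∈ Ico (n % d) (d - 1), auxSize (classSize n d i + 1) = 1 := by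
      intro i hi
      rw [mem_Ico] at hi
      rw [classSize_of_mod_le (by lia) hi.1, hdiv]
      rfl
    rw [classSize_of_mod_le (by lia) (by lia), hdiv, prod_eq_prod_Ico_succ_bot (by lia),
      Nat.sub_add_cancel hmod, prod_eq_one hsingle, classSize_of_lt_mod hd (by lia), hdiv]
    rfl
  | step m js aux hjs haux ih =>
    obtain ⟨t, rfl⟩ := haux.exists_eq_cons
    have hm := hjs.lt hd
    rw [length_expand _ (List.cons_ne_nil _ _), ih, haux.length_eq,
      prod_eq_prod_Ico_succ_bot (by lia : m < d - 1)]
    ring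

theorem prod_auxSize_classSize (hd : 0 < d) :
    ∏ i ∈ range (d - 1), auxSize (classSize n d i + 1) =
      auxSize (n / d + 2) ^ (n % d) * auxSize (n / d + 1) ^ (d - 1 - n % d) := by
  have hr := Nat.mod_lt n hd
  have hlarge : ∀ i ∈ range (n % d), auxSize (classSize n d i + 1) = auxSize (n / d + 2) :=
    fun i hi => by rw [classSize_of_lt_mod hd (mem_range.1 hi)]
  have hsmall : ∀ i ∈ Ico (n % d) (d - 1), auxSize (classSize n d i + 1) = auxSize (n / d + 1) :=
    fun i hi => by
      rw [mem_Ico] at hi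
      rw [classSize_of_mod_le (by lia) hi.1]
  rw [← prod_range_mul_prod_Ico _ (by lia : n % d ≤ d - 1), prod_congr rfl hlarge,
    prod_congr rfl hsmall, prod_const, prod_const, card_range, Nat.card_Ico]

theorem IsStage.length_eq_auxSize_pow (hd : 0 < d) (hn : d < n) (h : IsStage n d 0 js) :
    js.length = (n / d).factorial *
      (auxSize (n / d + 2) ^ (n % d) * auxSize (n / d + 1) ^ (d - 1 - n % d)) := by
  have hr := Nat.mod_lt n hd
  rw [h.length_eq hd hn, ← range_eq_Ico, prod_auxSize_classSize hd,
    classSize_of_mod_le (by lia) (by lia)]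

end Stages

/-! ## The size formula -/

theorem cast_factorial_div_two {k : ℕ} (hk : 2 ≤ k) :
    ((k.factorial / 2 : ℕ) : ℚ) = (k.factorial : ℚ) / 2 :=
  Nat.cast_div (Nat.dvd_factorial two_pos hk) two_ne_zero

theorem auxSize_of_odd {k : ℕ} (h2 : 2 ≤ k) (h5 : k ≠ 5) (hk : Odd k) :
    (auxSize k : ℚ) = (k.factorial : ℚ) / 2 := by
  rw [Nat.odd_iff] at hk
  rw [auxSize, if_neg (by lia), if_neg h5, if_neg (by lia), if_pos hk, cast_factorial_div_two h2]

theorem auxSize_of_even {k : ℕ} (h6 : 6 < k) (hk : Even k) :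
    (auxSize k : ℚ) = rho k * ((k.factorial : ℚ) / 2) := by
  rw [Nat.even_iff] at hk
  rw [auxSize, if_neg (by lia), if_neg (by lia), if_neg (by lia), if_neg (by lia), rho,
    div_mul_cancel₀ _ (by positivity)]
  push_cast [Nat.cast_sub (by lia : 3 ≤ k)]
  rw [cast_factorial_div_two (by lia)]

theorem rho_eq {k : ℕ} (hk : k ≠ 0) :
    rho k = ((k : ℚ) - 3) / k + (4 * k - 10) / (k.factorial : ℚ) := by
  obtain ⟨m, rfl⟩ := Nat.exists_eq_succ_of_ne_zero hk
  have hm : (m.factorial : ℚ) ≠ 0 := mod_cast m.factorial_ne_zero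
  have hm' : (m : ℚ) + 1 ≠ 0 := by positivity
  rw [rho, Nat.succ_eq_add_one, Nat.factorial_succ, Nat.add_sub_cancel]
  push_cast
  field_simp
  ring

theorem sub_three_div_lt_rho {k : ℕ} (hk : 3 ≤ k) : ((k : ℚ) - 3) / k < rho k := by
  have hk' : (3 : ℚ) ≤ k := mod_cast hk
  rw [rho_eq (by lia), lt_add_iff_pos_right]
  exact div_pos (by linarith) (by positivity)

theorem ceil_div_of_mod_ne_zero {n d : ℕ} (hr : n % d ≠ 0) (hd : 0 < d) :
    ⌈(n : ℚ) / d⌉₊ = n / d + 1 := by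
  have hd' : (0 : ℚ) < d := mod_cast hd
  have hdecomp := Nat.div_add_mod' n d
  have hlt := Nat.mod_lt n hd
  rw [Nat.ceil_eq_iff (by lia), Nat.add_sub_cancel, lt_div_iff₀ hd', div_le_iff₀ hd']
  norm_cast
  rw [add_one_mul]
  lia

theorem apply_ceil_div_pow_mod {n d : ℕ} (hd : 0 < d) (g : ℕ → ℚ) :
    g ⌈(n : ℚ) / d⌉₊ ^ (n % d) = g (n / d + 1) ^ (n % d) := by
  by_cases hr : n % d = 0
  · rw [hr, pow_zero, pow_zero]
  · rw [ceil_div_of_mod_ne_zero hr hd]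

theorem factorial_mul_pow_mul_pow {K : Type*} [Field K] [CharZero K] (f r e : ℕ) (x y : K) :
    (f.factorial : K) *
        ((x * ((f + 2).factorial / 2)) ^ r * (y * ((f + 1).factorial / 2)) ^ e) =
      ((f : K) + 2) ^ r * ((f + 1).factorial : K) ^ (r + e + 1) *
        (x ^ r * y ^ e / (2 ^ (r + e) * (f + 1))) := by
  have hf : (f : K) + 1 ≠ 0 := mod_cast f.succ_ne_zero
  rw [Nat.factorial_succ (f + 1), Nat.factorial_succ f]
  push_cast
  simp only [mul_pow, div_pow, pow_add, pow_one]
  field_simp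
  ring

theorem codeSize_of_five_lt {n d : ℕ} (hd : 0 < d) (hf : 5 < n / d) :
    codeSize n d = ((n / d).factorial : ℚ) *
      ((auxSize (n / d + 2) : ℚ) ^ (n % d) * (auxSize (n / d + 1) : ℚ) ^ (d - 1 - n % d)) := by
  have hr := Nat.mod_lt n hd
  have hcast := apply_ceil_div_pow_mod (n := n) hd fun c => (c : ℚ) + 1
  have hrho := apply_ceil_div_pow_mod (n := n) hd fun c => rho (c + 1)
  have hsub : n % d + (d - 1 - n % d) = d - 1 := by lia
  have hcast' : ((n / d + 1 : ℕ) : ℚ) + 1 = (n / d : ℕ) + 2 := by push_cast; ring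
  have hfactor := factorial_mul_pow_mul_pow (K := ℚ) (n / d) (n % d) (d - 1 - n % d)
  rw [hsub, Nat.sub_add_cancel hd] at hfactor
  simp only [codeSize, Nat.floor_div_eq_div, hcast, hrho, hcast']
  rcases Nat.even_or_odd (n / d) with heven | hodd
  · have hmod := Nat.even_iff.1 heven
    rw [if_pos ⟨by lia, hmod⟩, auxSize_of_even (by lia) (heven.add even_two),
      auxSize_of_odd (by lia) (by lia) heven.add_one]
    simpa using (hfactor (rho (n / d + 2)) 1).symm
  · have hmod := Nat.odd_iff.1 hodd
    rw [if_neg (by lia), if_neg (by lia), if_neg (by lia), if_pos ⟨hf, hmod⟩,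
      auxSize_of_odd (by lia) (by lia) (hodd.add_even even_two),
      auxSize_of_even (by lia) hodd.add_one]
    simpa using (hfactor 1 (rho (n / d + 1))).symm

theorem codeSize_of_le_five {n d : ℕ} (hd : 0 < d) (h1 : 1 ≤ n / d) (hf : n / d ≤ 5) :
    codeSize n d = ((n / d).factorial : ℚ) *
      ((auxSize (n / d + 2) : ℚ) ^ (n % d) * (auxSize (n / d + 1) : ℚ) ^ (d - 1 - n % d)) := by
  have hr : n % d ≤ d - 1 := Nat.le_sub_one_of_lt (Nat.mod_lt n hd)
  have hne : (auxSize (n / d + 1) : ℚ) ≠ 0 := by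
    generalize n / d = f at *
    interval_cases f <;> norm_num [auxSize, Nat.factorial]
  have hratio : (auxSize (n / d + 2) : ℚ) ^ (n % d) * (auxSize (n / d + 1) : ℚ) ^ (d - 1 - n % d) =
      ((auxSize (n / d + 2) : ℚ) / auxSize (n / d + 1)) ^ (n % d) *
        (auxSize (n / d + 1) : ℚ) ^ (d - 1) := by
    rw [div_pow, div_mul_eq_mul_div, mul_div_assoc, pow_sub₀ _ hne hr, div_eq_mul_inv]
  obtain ⟨e, he⟩ := Nat.exists_eq_add_one_of_ne_zero hd.ne'
  rw [hratio]
  simp only [codeSize, Nat.floor_div_eq_div]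
  generalize n / d = f at *
  generalize n % d = r at *
  subst he
  interval_cases f <;> norm_num [auxSize, Nat.factorial, pow_succ] <;> ring

theorem codeSize_eq {n d : ℕ} (hd : 0 < d) (hn : d ≤ n) :
    codeSize n d = ((n / d).factorial *
      (auxSize (n / d + 2) ^ (n % d) * auxSize (n / d + 1) ^ (d - 1 - n % d)) : ℕ) := by
  push_cast
  rcases lt_or_ge 5 (n / d) with hlarge | hsmall
  · exact codeSize_of_five_lt hd hlarge
  · exact codeSize_of_le_five hd (Nat.div_pos hn hd) hsmall

end PushGray

theorem mainTheorem8_general :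
    (∀ (n d : ℕ), 0 < d → d < n → ∀ (σ : Equiv.Perm (Fin n)) (js : List ℕ),
      PushGray.IsStage n d 0 js →
        ((PushGray.codewords 0 σ js).toFinset.card : ℚ) = PushGray.codeSize n d) ∧
    (∀ k : ℕ, 3 ≤ k → ((k : ℚ) - 3) / k < PushGray.rho k) := by
  refine ⟨fun n d hd hn σ js hjs => ?_, fun k => PushGray.sub_three_div_lt_rho⟩
  have hdistinct : (PushGray.codewords 0 σ js).Nodup := (hjs.isPushCode hd hn σ).distinct
  rw [List.toFinset_card_of_nodup hdistinct, PushGray.length_codewords,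
    hjs.length_eq_auxSize_pow hd hn, PushGray.codeSize_eq hd hn.le]

theorem mainTheorem8 :
    (∀ (n d : ℕ), 0 < d → d < n → ∀ C : List (Equiv.Perm (Fin n)),
      PushGray.IsConstructedCode n d C → (C.toFinset.card : ℚ) = PushGray.codeSize n d) ∧
    (∀ k : ℕ, 6 < k → Even k → ((k : ℚ) - 3) / k < PushGray.rho k) :=
  ⟨fun n d hd hn _ ⟨σ₀, js, _, hjs, hC⟩ => hC ▸ mainTheorem8_general.1 n d hd hn σ₀ js hjs,
    fun k hk _ => mainTheorem8_general.2 k (by lia)⟩
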